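/- Let $(A_k)_{k\in\mathbb{N}}$ be a family of maximally monotone operators from $\mathbb{R}$ to $2^{\mathbb{R}}$, and define $$A\colon\ell^2(\mathbb{N})\to 2^{\ell^2(\mathbb{N})}\colon (x_k)_{k\in\mathbb{N}}\mapsto\{(x_k^*)_{k\in\mathbb{N}}\in\ell^2(\mathbb{N}) \mid (\forall k\in\mathbb{N})\ x_k^*\in A_k x_k\}.$$ Suppose that $\operatorname{dom}A=\{x\in\ell^2(\mathbb{N})\mid Ax\neq\varnothing\}\neq\varnothing$. Then $A$ is maximally monotone, and there exists $f\in\Gamma_0(\ell^2(\mathbb{N}))$ such that $A=\partial f$. Here, for a real Hilbert space $H$, an operator $B\colon H\to 2^H$ is monotone if $\langle x-y, x^*-y^*\rangle\ge 0$ whenever $x^*\in Bx$ and $y^*\in By$, and maximally monotone if moreover no monotone operator on $H$ has a graph strictly containing the graph $\{(x,x^*)\mid x^*\in Bx\}$ of $B$; $\Gamma_0(H)$ is the class of lower semicontinuous convex functions $f\colon H\to\left]-\infty,+\infty\right]$ with $f(x)<+\infty$ for at least one $x$; and $\partial f(x)=\{x^*\in H\mid (\forall y\in H)\ \langle y-x,x^*\rangle+f(x)\le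 f(y)\}$. -/

import Mathlib

namespace MonotoneOperator

section Hilbert

variable {H : Type*} [NormedAddCommGroup H] [InnerProductSpace ℝ H]

/-- The domain of a set-valued operator `A : H → 2^H`. -/
def dom (A : H → Set H) : Set H := {x | (A x).Nonempty}

/-- The graph of a set-valued operator `A : H → 2^H`. -/
def gra (A : H → Set H) : Set (H × H) := {p | p.2 ∈ A p.1}

/-- Monotone set-valued operators: `⟪x - y, x* - y*⟫ ≥ 0` on the graph. -/
def IsMonotone (A : H → Set H) : Prop :=
  ∀ p ∈ gra A, ∀ q ∈ gra A, 0 ≤ inner ℝ (p.1 - q.1) (p.2 - q.2)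

/-- `A` is monotone and no monotone operator has a strictly larger graph. -/
def IsMaximallyMonotone (A : H → Set H) : Prop :=
  IsMonotone A ∧
    ¬ ∃ B : H → Set H, IsMonotone B ∧ gra A ⊆ gra B ∧ gra B ≠ gra A

/-- The class `Γ₀(H)` of functions `H → ]-∞, +∞]` which are lower semicontinuous, convex and
finite at some point. -/
structure IsGammaZero (f : H → EReal) : Prop where
  ne_bot : ∀ x, f x ≠ ⊥
  lowerSemicontinuous : LowerSemicontinuous f
  convex : ∀ x y : H, ∀ a b : ℝ, 0 < a → 0 < b → a + b = 1 →
    f (a • x + b • y) ≤ (a : EReal) * f x + (b : EReal) * f y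
  exists_lt_top : ∃ x, f x < ⊤

/-- The subdifferential of `f`. -/
def subdifferential (f : H → EReal) : H → Set H := fun x =>
  {xs | ∀ y : H, ((inner ℝ (y - x) xs : ℝ) : EReal) + f x ≤ f y}

end Hilbert

/-- The componentwise product, acting on `ℓ²(ℕ)`, of a family of operators on `ℝ`. -/
def ell2Product (A : ℕ → ℝ → Set ℝ) :
    lp (fun _ : ℕ => ℝ) 2 → Set (lp (fun _ : ℕ => ℝ) 2) := fun x =>
  {xs | ∀ k, xs k ∈ A k (x k)}

end MonotoneOperator

namespace MonotoneOperator

section Hilbert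

variable {H : Type*} [NormedAddCommGroup H] [InnerProductSpace ℝ H]

/-! Monotonicity on the line is the hypothesis of the rearrangement inequality, so each `A k` is
cyclically monotone, and summing over coordinates passes this to the product. Rockafellar's
antiderivative then has a monotone subdifferential containing the product, and maximality forces
equality. Maximality follows from Minty's criterion: the resolvent equation is solved in each
coordinate, and comparison with one known point of the graph keeps the solution in ℓ². -/

/-- A point monotonically related to the graph of a maximally monotone operator belongs to it. -/
theorem IsMaximallyMonotone.mem_of_forall_inner_nonneg {A : H → Set H}
    (hA : IsMaximallyMonotone A) {x xs : H}
    (h : ∀ p ∈ gra A, 0 ≤ inner ℝ (x - p.1) (xs - p.2)) : xs ∈ A x := by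
  by_contra hx
  refine hA.2 ⟨fun y => {ys | ys ∈ A y ∨ (y = x ∧ ys = xs)}, ?_, fun p hp => Or.inl hp, ?_⟩
  · rintro ⟨p, ps⟩ (hp | ⟨rfl, rfl⟩) ⟨q, qs⟩ (hq | ⟨rfl, rfl⟩)
    · exact hA.1 _ hp _ hq
    · have := h _ hp
      rw [← neg_sub p, ← neg_sub ps, inner_neg_neg] at this
      exact this
    · exact h _ hq
    · simp
  · intro he
    have : (x, xs) ∈ gra A := he ▸ (Or.inr ⟨rfl, rfl⟩ : _ ∨ _)
    exact hx this

/-- The easy half of Minty's theorem: a monotone operator `A` such that `Id + A` is surjective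
is maximally monotone. -/
theorem IsMonotone.isMaximallyMonotone_of_surjective {A : H → Set H} (hA : IsMonotone A)
    (hs : ∀ z, ∃ x, z - x ∈ A x) : IsMaximallyMonotone A := by
  refine ⟨hA, ?_⟩
  rintro ⟨B, hB, hAB, hne⟩
  refine hne (Set.Subset.antisymm ?_ hAB)
  rintro ⟨y, ys⟩ hy
  obtain ⟨x, hx⟩ := hs (y + ys)
  have h := hB _ hy _ (hAB (show (x, y + ys - x) ∈ gra A from hx))
  have hxy : y = x := by
    have e : ys - (y + ys - x) = -(y - x) := by abel
    simp only [e, inner_neg_right, real_inner_self_eq_norm_sq] at h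
    have : ‖y - x‖ = 0 := by nlinarith [norm_nonneg (y - x)]
    exact sub_eq_zero.1 (norm_eq_zero.1 this)
  subst hxy
  simpa [gra] using hx

/-- Cyclic monotonicity, expressed with arbitrary permutations of finite families in the graph. -/
def IsCyclicallyMonotone (A : H → Set H) : Prop :=
  ∀ (n : ℕ) (p : Fin n → H × H) (σ : Equiv.Perm (Fin n)), (∀ i, p i ∈ gra A) →
    ∑ i, inner ℝ (p (σ i)).1 (p i).2 ≤ ∑ i, inner ℝ (p i).1 (p i).2

/-- The affine function attached to the chain `p 0, …, p n` in Rockafellar's construction. -/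
def chainValue (p : ℕ → H × H) (n : ℕ) (y : H) : ℝ :=
  ∑ i ∈ Finset.range n, inner ℝ ((p (i + 1)).1 - (p i).1) (p i).2 +
    inner ℝ (y - (p n).1) (p n).2

/-- Rockafellar's antiderivative of `A` with base point `b`. -/
noncomputable def antiderivative (A : H → Set H) (b : H × H) (y : H) : EReal :=
  ⨆ q : {q : ℕ × (ℕ → H × H) // q.2 0 = b ∧ ∀ i, q.2 i ∈ gra A},
    (chainValue q.1.2 q.1.1 y : EReal)

theorem chainValue_le_antiderivative {A : H → Set H} {b : H × H} {p : ℕ → H × H} (h0 : p 0 = b)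
    (hp : ∀ i, p i ∈ gra A) (n : ℕ) (y : H) :
    (chainValue p n y : EReal) ≤ antiderivative A b y :=
  le_iSup (fun q : {q : ℕ × (ℕ → H × H) // q.2 0 = b ∧ ∀ i, q.2 i ∈ gra A} =>
    (chainValue q.1.2 q.1.1 y : EReal)) ⟨(n, p), h0, hp⟩

theorem continuous_chainValue (p : ℕ → H × H) (n : ℕ) : Continuous (chainValue p n) := by
  unfold chainValue
  fun_prop

theorem chainValue_convexCombination (p : ℕ → H × H) (n : ℕ) (x y : H) {a b : ℝ}
    (hab : a + b = 1) :
    chainValue p n (a • x + b • y) = a * chainValue p n x + b * chainValue p n y := by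
  obtain rfl : b = 1 - a := by linarith
  simp only [chainValue, inner_sub_left, inner_add_left, real_inner_smul_left]
  ring

theorem IsCyclicallyMonotone.chainValue_nonpos {A : H → Set H} (hA : IsCyclicallyMonotone A)
    {p : ℕ → H × H} (hp : ∀ i, p i ∈ gra A) (n : ℕ) : chainValue p n (p 0).1 ≤ 0 := by
  -- The cyclic shift closes the chain: the last point is paired with `p 0`.
  have h := hA (n + 1) (fun i => p i) (finRotate (n + 1)) fun i => hp i
  rw [Fin.sum_univ_castSucc, Fin.sum_univ_castSucc, finRotate_last] at h
  have e : ∀ i : Fin n, ((finRotate (n + 1) i.castSucc : Fin (n + 1)) : ℕ) = i + 1 := fun i => by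
    rw [coe_finRotate_of_ne_last (Fin.castSucc_lt_last i).ne]; rfl
  simp only [e, Fin.val_castSucc, Fin.val_last, Fin.val_zero] at h
  rw [Fin.sum_univ_eq_sum_range (fun i => inner ℝ (p (i + 1)).1 (p i).2),
    Fin.sum_univ_eq_sum_range (fun i => inner ℝ (p i).1 (p i).2)] at h
  simp only [chainValue, inner_sub_left, Finset.sum_sub_distrib]
  linarith

theorem IsCyclicallyMonotone.antiderivative_base_le {A : H → Set H}
    (hA : IsCyclicallyMonotone A) (b : H × H) : antiderivative A b b.1 ≤ 0 := by
  refine iSup_le ?_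
  rintro ⟨⟨n, p⟩, rfl, hp⟩
  exact_mod_cast hA.chainValue_nonpos hp n

theorem IsCyclicallyMonotone.isGammaZero_antiderivative {A : H → Set H}
    (hA : IsCyclicallyMonotone A) {b : H × H} (hb : b ∈ gra A) :
    IsGammaZero (antiderivative A b) where
  ne_bot x := ((EReal.bot_lt_coe _).trans_le (chainValue_le_antiderivative
    (p := fun _ => b) rfl (fun _ => hb) 0 x)).ne'
  lowerSemicontinuous := lowerSemicontinuous_iSup fun q =>
    (continuous_coe_real_ereal.comp (continuous_chainValue _ _)).lowerSemicontinuous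
  convex x y s t hs ht hst := by
    refine iSup_le ?_
    rintro ⟨⟨n, p⟩, h0, hp⟩
    rw [chainValue_convexCombination _ _ _ _ hst, EReal.coe_add, EReal.coe_mul, EReal.coe_mul]
    have hs' : (0 : EReal) ≤ s := by exact_mod_cast hs.le
    have ht' : (0 : EReal) ≤ t := by exact_mod_cast ht.le
    exact add_le_add (mul_le_mul_of_nonneg_left (chainValue_le_antiderivative h0 hp n x) hs')
      (mul_le_mul_of_nonneg_left (chainValue_le_antiderivative h0 hp n y) ht')
  exists_lt_top := ⟨b.1, (hA.antiderivative_base_le b).trans_lt EReal.zero_lt_top⟩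

/-- Appending `(x, xs)` to a chain turns its value at `x` into a value at `y` larger by `⟪y - x,
xs⟫`; then take the supremum over chains. -/
theorem gra_subset_gra_subdifferential_antiderivative (A : H → Set H) (b : H × H) :
    gra A ⊆ gra (subdifferential (antiderivative A b)) := by
  rintro ⟨x, xs⟩ hx y
  rw [add_comm]
  refine EReal.add_le_of_le_sub (iSup_le ?_)
  rintro ⟨⟨n, p⟩, h0, hp⟩
  rw [EReal.le_sub_iff_add_le (by simp) (by simp), ← EReal.coe_add]
  have hle := chainValue_le_antiderivative (A := A) (b := b)
    (p := fun i => if i ≤ n then p i else (x, xs)) (by simpa using h0)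
    (fun i => by split_ifs; exacts [hp i, hx]) (n + 1) y
  refine le_trans (EReal.coe_le_coe_iff.2 (le_of_eq ?_)) hle
  have hsum : ∑ i ∈ Finset.range n, inner ℝ ((p (i + 1)).1 - (p i).1) (p i).2 =
      ∑ i ∈ Finset.range n, inner ℝ ((if i + 1 ≤ n then p (i + 1) else (x, xs)).1 -
        (if i ≤ n then p i else (x, xs)).1) (if i ≤ n then p i else (x, xs)).2 :=
    Finset.sum_congr rfl fun i hi => by
      have := Finset.mem_range.1 hi
      rw [if_pos (by omega), if_pos (by omega)]
  simp only [chainValue, Finset.sum_range_succ, hsum]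
  simp

theorem IsGammaZero.isMonotone_subdifferential {f : H → EReal} (hf : IsGammaZero f) :
    IsMonotone (subdifferential f) := by
  obtain ⟨u, hu⟩ := hf.exists_lt_top
  -- An infinite value at a point with a subgradient would force `f u = ⊤`.
  have fin : ∀ p ∈ gra (subdifferential f), f p.1 ≠ ⊤ := fun p hp ht => by
    have := hp u
    rw [ht, EReal.coe_add_top] at this
    exact (this.trans_lt hu).false
  intro p hp q hq
  have h1 := hp q.1
  have h2 := hq p.1
  lift f p.1 to ℝ using ⟨fin p hp, hf.ne_bot _⟩ with r
  lift f q.1 to ℝ using ⟨fin q hq, hf.ne_bot _⟩ with s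
  norm_cast at h1 h2
  simp only [inner_sub_left, inner_sub_right] at h1 h2 ⊢
  linarith

theorem IsMaximallyMonotone.exists_eq_subdifferential {A : H → Set H}
    (hA : IsMaximallyMonotone A) (hc : IsCyclicallyMonotone A) (hd : (dom A).Nonempty) :
    ∃ f : H → EReal, IsGammaZero f ∧ A = subdifferential f := by
  obtain ⟨x, xs, hx⟩ := hd
  have hf := hc.isGammaZero_antiderivative (b := (x, xs)) hx
  refine ⟨_, hf, ?_⟩
  have hg := gra_subset_gra_subdifferential_antiderivative A (x, xs)
  have he : gra (subdifferential (antiderivative A (x, xs))) = gra A := by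
    by_contra hne
    exact hA.2 ⟨_, hf.isMonotone_subdifferential, hg, hne⟩
  funext y
  ext ys
  exact (Set.ext_iff.1 he (y, ys)).symm

end Hilbert

/-- Monotone operators on the real line are cyclically monotone. -/
theorem IsMonotone.isCyclicallyMonotone_real {A : ℝ → Set ℝ} (hA : IsMonotone A) :
    IsCyclicallyMonotone A := by
  intro n p σ hp
  have hm : Monovary (fun i => (p i).2) (fun i => (p i).1) := by
    intro i j hij
    have := hA _ (hp i) _ (hp j)
    simp only [RCLike.inner_apply, conj_trivial] at this
    dsimp only at hij ⊢
    nlinarith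
  simpa [RCLike.inner_apply] using hm.sum_mul_comp_perm_le_sum_mul (σ := σ)

/-- Minty's theorem on the real line. -/
theorem IsMaximallyMonotone.exists_sub_mem_real {A : ℝ → Set ℝ} (hA : IsMaximallyMonotone A)
    (hd : (dom A).Nonempty) (z : ℝ) : ∃ x, z - x ∈ A x := by
  have hne : (gra A).Nonempty := let ⟨x, xs, h⟩ := hd; ⟨(x, xs), h⟩
  -- The point `(x, z - x)` is monotonically related to `p` exactly when `x` lies between `p.1` and
  -- `z - p.2`. Monotonicity makes these intervals meet pairwise, hence they all share a point.
  obtain ⟨x, hx⟩ := exists_between_of_forall_le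
    (hne.image fun p => min p.1 (z - p.2)) (hne.image fun p => max p.1 (z - p.2)) (by
      rintro _ ⟨p, hp, rfl⟩ _ ⟨q, hq, rfl⟩
      by_contra! hlt
      have h := hA.1 _ hp _ hq
      simp only [RCLike.inner_apply, conj_trivial] at h
      obtain ⟨h1, h2⟩ := lt_min_iff.1 hlt
      have h3 := (max_lt_iff.1 h1).1
      have h4 := (max_lt_iff.1 h2).2
      nlinarith)
  refine ⟨x, hA.mem_of_forall_inner_nonneg fun p hp => ?_⟩
  have h1 := hx.1 ⟨p, hp, rfl⟩
  have h2 := hx.2 ⟨p, hp, rfl⟩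
  simp only [RCLike.inner_apply, conj_trivial]
  rcases min_le_iff.1 h1 with h1 | h1 <;> rcases le_max_iff.1 h2 with h2 | h2 <;>
    rcases le_total p.1 (z - p.2) with h | h <;> simp only [h, min_eq_left, min_eq_right,
      max_eq_left, max_eq_right] at * <;> nlinarith

/-- Resolvents are nonexpansive: `x` and `u` are the resolvent values at `z` and `u + v`. -/
theorem IsMonotone.abs_sub_le_of_sub_mem {A : ℝ → Set ℝ} (hA : IsMonotone A) {x z u v : ℝ}
    (hx : z - x ∈ A x) (hu : v ∈ A u) : |x - u| ≤ |z - (u + v)| := by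
  have h := hA (x, z - x) hx (u, v) hu
  simp only [RCLike.inner_apply, conj_trivial] at h
  by_contra! hlt
  have h1 : (x - u) ^ 2 ≤ |x - u| * |z - (u + v)| := by
    rw [← abs_mul]
    exact le_trans (by nlinarith) (le_abs_self _)
  nlinarith [sq_abs (x - u), abs_nonneg (z - (u + v))]

theorem IsMonotone.ell2Product {A : ℕ → ℝ → Set ℝ} (hA : ∀ k, IsMonotone (A k)) :
    IsMonotone (ell2Product A) := fun p hp q hq =>
  (lp.hasSum_inner (𝕜 := ℝ) (p.1 - q.1) (p.2 - q.2)).nonneg fun k =>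
    hA k (p.1 k, p.2 k) (hp k) (q.1 k, q.2 k) (hq k)

theorem IsCyclicallyMonotone.ell2Product {A : ℕ → ℝ → Set ℝ}
    (hA : ∀ k, IsCyclicallyMonotone (A k)) : IsCyclicallyMonotone (ell2Product A) :=
  fun n p σ hp => hasSum_le
    (fun k => hA k n (fun i => ((p i).1 k, (p i).2 k)) σ fun i => hp i k)
    (hasSum_sum fun i _ => lp.hasSum_inner (𝕜 := ℝ) (p (σ i)).1 (p i).2)
    (hasSum_sum fun i _ => lp.hasSum_inner (𝕜 := ℝ) (p i).1 (p i).2)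

theorem IsMaximallyMonotone.ell2Product {A : ℕ → ℝ → Set ℝ}
    (hA : ∀ k, IsMaximallyMonotone (A k)) (hd : (dom (ell2Product A)).Nonempty) :
    IsMaximallyMonotone (ell2Product A) := by
  refine (IsMonotone.ell2Product fun k => (hA k).1).isMaximallyMonotone_of_surjective fun z => ?_
  obtain ⟨u, v, huv⟩ := hd
  choose x hx using fun k => (hA k).exists_sub_mem_real ⟨u k, v k, huv k⟩ (z k)
  -- Only the difference from `u` is controlled directly: it is dominated by `z - (u + v)`, which is
  -- in ℓ².
  have hmem : Memℓp (fun k => x k - u k) 2 :=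
    memℓp_gen (((lp.memℓp (z - (u + v))).summable (by simp)).of_nonneg_of_le
      (fun k => by positivity) fun k => Real.rpow_le_rpow (norm_nonneg _)
        ((hA k).1.abs_sub_le_of_sub_mem (hx k) (huv k)) (by simp))
  refine ⟨⟨fun k => x k - u k, hmem⟩ + u, fun k => ?_⟩
  have e : (x k - u k) + u k = x k := sub_add_cancel _ _
  change z k - ((x k - u k) + u k) ∈ A k ((x k - u k) + u k)
  rw [e]
  exact hx k

end MonotoneOperator

theorem mainTheorem11 (A : ℕ → ℝ → Set ℝ)
    (hA : ∀ k, MonotoneOperator.IsMaximallyMonotone (A k))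
    (hdom : (MonotoneOperator.dom (MonotoneOperator.ell2Product A)).Nonempty) :
    MonotoneOperator.IsMaximallyMonotone (MonotoneOperator.ell2Product A) ∧
      ∃ f : lp (fun _ : ℕ => ℝ) 2 → EReal,
        MonotoneOperator.IsGammaZero f ∧
          MonotoneOperator.ell2Product A = MonotoneOperator.subdifferential f := by
  have hmax := MonotoneOperator.IsMaximallyMonotone.ell2Product hA hdom
  exact ⟨hmax, hmax.exists_eq_subdifferential (MonotoneOperator.IsCyclicallyMonotone.ell2Product
    fun k => (hA k).1.isCyclicallyMonotone_real) hdom⟩
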